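/- Let $r\ge 2$ and consider the root system of type $A_r$ in $\mathbb{R}^{r+1}$, with simple roots $\alpha_i=e_i-e_{i+1}$ ($1\le i\le r$), positive roots $\alpha_i+\alpha_{i+1}+\cdots+\alpha_j$ ($1\le i\le j\le r$), highest root $\tilde\alpha=\alpha_1+\cdots+\alpha_r$, half-sum of positive roots $\rho$, and Weyl group $W$ generated by the reflections $s_i$ through the hyperplanes orthogonal to the $\alpha_i$. Let $\wp(\xi)$ be the number of ways of writing $\xi$ as a linear combination of positive roots with nonnegative integer coefficients, and for weights $\lambda,\mu$ let $$\mathcal{A}(\lambda,\mu)=\{\sigma\in W : \wp(\sigma(\lambda+\rho)-\mu-\rho)>0\}$$ be the Weyl alternation set. For $\sigma\in W$ let $I(\sigma)$ be the set of all $i$ such that $s_i$ occurs in a reduced word of $\sigma$, and let $\overline I(\sigma)$ be $I(\sigma)$ together with all vertices adjacent in the Dynkin diagram to an element of $I(\sigma)$. Say that $\sigma$ has connected influence if $I(\sigma)$ induces a connected subgraph of the Dynkin diagram, that $\sigma,\tau$ are independent if $I(\sigma)\cap\overline I(\tau)=\emptyset$, and that a subset of $W$ is pairwise independent if any two distinct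 elements of it are independent. The set $\mathrm{BAS}(\lambda,\mu)$ of basic allowable subwords is the unique subset $S\subseteq\mathcal{A}(\lambda,\mu)$ with $1\notin S$ such that every $b\in S$ has connected influence and every $\sigma\in\mathcal{A}(\lambda,\mu)$ is the product of the elements of a (possibly empty) pairwise independent subset of $S$. Then there is exactly one set $S$ with these properties for $(\lambda,\mu)=(\tilde\alpha,-\tilde\alpha)$, and it, that is $\mathrm{BAS}(\tilde\alpha,-\tilde\alpha)$, consists exactly of the following elements: - $s_k$ with $1\le k\le r$; - $s_{k+1}s_k$ with $2\le k\le r-2$; - $s_ks_{k+1}$ with $2\le k\le r-2$; - $s_ks_{k+1}s_k$ with $2\le k\le r-2$; - $s_{k+2}s_ks_{k+1}$ with $2\le k\le r-3$. -/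

import Mathlib

namespace TypeA

noncomputable section

open scoped InnerProductSpace

/-- The Euclidean space `ℝ^(r+1)` in which the root system of type `A_r` lives. -/
abbrev V (r : ℕ) : Type := EuclideanSpace ℝ (Fin (r + 1))

/-- The simple roots `e_i - e_{i+1}`, indexed by `Fin r`. The index `i : Fin r` corresponds to the
label `i + 1` of the usual numbering `α_1, …, α_r`. -/
def simpleRoot (r : ℕ) (i : Fin r) : V r :=
  EuclideanSpace.single i.castSucc (1 : ℝ) - EuclideanSpace.single i.succ (1 : ℝ)

/-- Index set of the positive roots: pairs `i ≤ j`. -/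
abbrev PosIndex (r : ℕ) : Type := {p : Fin r × Fin r // p.1 ≤ p.2}

/-- The positive root `α_{i,j} = α_i + α_{i+1} + ⋯ + α_j`, for `i ≤ j`. -/
def posRoot (r : ℕ) (p : PosIndex r) : V r :=
  ∑ k ∈ Finset.Icc p.1.1 p.1.2, simpleRoot r k

/-- The highest root `α_1 + ⋯ + α_r`. -/
def highestRoot (r : ℕ) : V r := ∑ k, simpleRoot r k

/-- Half the sum of the positive roots. -/
def rho (r : ℕ) : V r := (1 / 2 : ℝ) • ∑ p : PosIndex r, posRoot r p

/-- Reflection through the hyperplane orthogonal to the simple root `α_i`. -/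
def simpleReflection (r : ℕ) (i : Fin r) : V r ≃ₗᵢ[ℝ] V r :=
  (Submodule.span ℝ {simpleRoot r i})ᗮ.reflection

/-- The Weyl group: the group of isometries generated by the simple reflections. -/
def weylGroup (r : ℕ) : Subgroup (V r ≃ₗᵢ[ℝ] V r) :=
  Subgroup.closure (Set.range (simpleReflection r))

/-- The simple reflections as elements of the Weyl group. -/
def refl (r : ℕ) (i : Fin r) : weylGroup r :=
  ⟨simpleReflection r i, Subgroup.subset_closure (Set.mem_range_self i)⟩

/-- `s r k` is the simple reflection `s_k` in the usual numbering `1 ≤ k ≤ r`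
(outside this range, the identity). -/
def s (r k : ℕ) : weylGroup r :=
  if h : 1 ≤ k ∧ k ≤ r then refl r ⟨k - 1, by omega⟩ else 1

/-- Kostant's partition function: the number of ways to write `ξ` as a linear combination of the
positive roots with nonnegative integer coefficients. -/
def kostant (r : ℕ) (ξ : V r) : ℕ :=
  Set.ncard {c : PosIndex r → ℕ | ∑ p, (c p : ℝ) • posRoot r p = ξ}

/-- The Weyl alternation set of `lam` and `mu`. -/
def alternationSet (r : ℕ) (lam mu : V r) : Set (weylGroup r) :=
  {σ | 0 < kostant r ((σ : V r ≃ₗᵢ[ℝ] V r) (lam + rho r) - mu - rho r)}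

/-- `ω` is a reduced word of `σ`: an expression of `σ` as a product of simple reflections of
minimal length. -/
def IsReducedWord (r : ℕ) (ω : List (Fin r)) (σ : weylGroup r) : Prop :=
  (ω.map (refl r)).prod = σ ∧
    ∀ ω' : List (Fin r), (ω'.map (refl r)).prod = σ → ω.length ≤ ω'.length

/-- The Dynkin diagram: distinct vertices are joined if and only if the simple roots are not
orthogonal. -/
def dynkin (r : ℕ) : SimpleGraph (Fin r) where
  Adj i j := i ≠ j ∧ ⟪simpleRoot r i, simpleRoot r j⟫_ℝ ≠ 0
  symm := ⟨fun i j h => ⟨h.1.symm, by rw [real_inner_comm]; exact h.2⟩⟩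
  loopless := ⟨fun _ h => h.1 rfl⟩

/-- The influence of `σ`: the labels occurring in a reduced word of `σ`. -/
def influence (r : ℕ) (σ : weylGroup r) : Set (Fin r) :=
  {i | ∃ ω, IsReducedWord r ω σ ∧ i ∈ ω}

/-- The extended influence of `σ`: the influence together with the adjacent vertices of the Dynkin
diagram. -/
def extendedInfluence (r : ℕ) (σ : weylGroup r) : Set (Fin r) :=
  {i | i ∈ influence r σ ∨ ∃ j ∈ influence r σ, (dynkin r).Adj i j}

/-- The influence of `σ` induces a connected subgraph of the Dynkin diagram. -/
def HasConnectedInfluence (r : ℕ) (σ : weylGroup r) : Prop :=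
  ((dynkin r).induce (influence r σ)).Connected

/-- Independence of two Weyl group elements. -/
def Independent (r : ℕ) (σ τ : weylGroup r) : Prop :=
  influence r σ ∩ extendedInfluence r τ = ∅

/-- Pairwise independent sets of Weyl group elements. -/
def PairwiseIndependent (r : ℕ) (B : Set (weylGroup r)) : Prop :=
  ∀ σ ∈ B, ∀ τ ∈ B, σ ≠ τ → Independent r σ τ

/-- `S` is a set of basic allowable subwords for `lam` and `mu`: a subset of the Weyl alternation
set without the identity, all of whose elements have connected influence, such that each element of
the alternation set is the product of the distinct elements `l` of a (possibly empty) pairwise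
independent subset of `S`. -/
def IsBAS (r : ℕ) (lam mu : V r) (S : Set (weylGroup r)) : Prop :=
  S ⊆ alternationSet r lam mu ∧
  1 ∉ S ∧
  (∀ b ∈ S, HasConnectedInfluence r b) ∧
  ∀ σ ∈ alternationSet r lam mu, ∃ l : List (weylGroup r),
    l.Nodup ∧ (∀ b ∈ l, b ∈ S) ∧ PairwiseIndependent r {b | b ∈ l} ∧ l.prod = σ

theorem simpleRoot_apply (r : ℕ) (k : Fin r) (j : Fin (r + 1)) :
    simpleRoot r k j = (if j.val = k.val then 1 else 0) - (if j.val = k.val + 1 then 1 else 0) := by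
  simp [simpleRoot, Fin.ext_iff]

theorem partialSum_simpleRoot (r : ℕ) (k m : Fin r) :
    ∑ j ∈ Finset.univ.filter (fun j : Fin (r + 1) => j.val ≤ m.val), simpleRoot r k j =
      if k = m then 1 else 0 := by
  simp only [simpleRoot_apply, Finset.sum_sub_distrib]
  have h1 : ∀ a : ℕ, a < r + 1 → ∑ j ∈ Finset.univ.filter (fun j : Fin (r + 1) => j.val ≤ m.val),
      (if j.val = a then (1 : ℝ) else 0) = if a ≤ m.val then 1 else 0 := by
    intro a ha
    have : ∀ j : Fin (r + 1), (j.val = a) ↔ (j = ⟨a, ha⟩) := fun j => by simp [Fin.ext_iff]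
    simp only [this, Finset.sum_ite_eq', Finset.mem_filter, Finset.mem_univ, true_and]
  rw [h1 _ (by omega), h1 _ (by omega)]
  have := k.isLt
  simp only [Fin.ext_iff]
  split_ifs <;> first | omega | norm_num

/-- The coordinates of a positive root in the simple roots. -/
theorem partialSum_posRoot (r : ℕ) (p : PosIndex r) (m : Fin r) :
    ∑ j ∈ Finset.univ.filter (fun j : Fin (r + 1) => j.val ≤ m.val), posRoot r p j =
      if p.1.1 ≤ m ∧ m ≤ p.1.2 then 1 else 0 := by
  have : ∀ j, posRoot r p j = ∑ k ∈ Finset.Icc p.1.1 p.1.2, simpleRoot r k j := by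
    intro j; simp [posRoot]
  simp only [this]
  rw [Finset.sum_comm]
  simp only [partialSum_simpleRoot]
  simp

/-- Distinct indices give distinct positive roots. -/
theorem posRoot_injective (r : ℕ) : Function.Injective (posRoot r) := by
  intro p q h
  have key : ∀ m, (p.1.1 ≤ m ∧ m ≤ p.1.2) ↔ (q.1.1 ≤ m ∧ m ≤ q.1.2) := by
    intro m
    have h1 := partialSum_posRoot r p m
    rw [h, partialSum_posRoot] at h1
    by_cases hp : p.1.1 ≤ m ∧ m ≤ p.1.2 <;> by_cases hq : q.1.1 ≤ m ∧ m ≤ q.1.2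
    · exact ⟨fun _ => hq, fun _ => hp⟩
    · rw [if_pos hp, if_neg hq] at h1; norm_num at h1
    · rw [if_neg hp, if_pos hq] at h1; norm_num at h1
    · exact ⟨fun h => absurd h hp, fun h => absurd h hq⟩
  have a := (key p.1.1).1 ⟨le_rfl, p.2⟩
  have b := (key p.1.2).1 ⟨p.2, le_rfl⟩
  have c := (key q.1.1).2 ⟨le_rfl, q.2⟩
  have d := (key q.1.2).2 ⟨q.2, le_rfl⟩
  exact Subtype.ext (Prod.ext (le_antisymm c.1 a.1) (le_antisymm b.2 d.2))

/-- A vector has only finitely many partitions into positive roots. -/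
theorem finite_partitions (r : ℕ) (ξ : V r) :
    {c : PosIndex r → ℕ | ∑ p, (c p : ℝ) • posRoot r p = ξ}.Finite := by
  set x : Fin r → ℝ := fun m =>
    ∑ j ∈ Finset.univ.filter (fun j : Fin (r + 1) => j.val ≤ m.val), ξ j with hx
  refine Set.Finite.subset (Set.finite_Iic (fun p : PosIndex r => ⌊x p.1.1⌋₊)) ?_
  intro c hc p
  refine Nat.le_floor ?_
  have hc : ∑ p, (c p : ℝ) • posRoot r p = ξ := hc
  have : x p.1.1 = ∑ q : PosIndex r, (c q : ℝ) *
      (if q.1.1 ≤ p.1.1 ∧ p.1.1 ≤ q.1.2 then 1 else 0) := by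
    simp only [hx, ← hc, ← partialSum_posRoot, Finset.mul_sum]
    rw [Finset.sum_comm]
    simp
  rw [this]
  have h2 := Finset.single_le_sum (f := fun q : PosIndex r => (c q : ℝ) *
      (if q.1.1 ≤ p.1.1 ∧ p.1.1 ≤ q.1.2 then 1 else 0)) (s := Finset.univ)
      (fun q _ => by positivity) (Finset.mem_univ p)
  simpa [p.2] using h2

/-- The usual formula for a simple reflection. -/
theorem simpleReflection_apply (r : ℕ) (i : Fin r) (v : V r) :
    simpleReflection r i v = v -
      (2 * ⟪simpleRoot r i, v⟫_ℝ / ⟪simpleRoot r i, simpleRoot r i⟫_ℝ) • simpleRoot r i := by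
  rw [simpleReflection, Submodule.reflection_orthogonal_apply, Submodule.reflection_singleton_apply,
    real_inner_self_eq_norm_sq]
  simp only [RCLike.ofReal_real_eq_id, id]
  module

end

end TypeA

/-! The Weyl group is the symmetric group on the `r + 1` coordinates (`weylEquiv`), and both notions
in the definition become statements about cuts. By the exchange argument in `exists_shorter_word`, a
label lies in the influence of a permutation exactly when the permutation does not preserve the cut
at that label (`mem_influence_iff`). Since simple roots are themselves positive roots, `kostant` is
positive exactly when all simple-root coefficients are nonnegative; these are partial sums of
coordinates, so `mem_alternationSet_iff` bounds a partial sum, the `excess`, by 1 at every cut.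

The identity has excess -1 at every cut, so a rearrangement may raise a partial sum by at most 2.
Read from the first moved position, this leaves only the listed patterns (`rearrangement_cases`).
Each ends at a preserved cut, so it can be split off and the rest treated in the same way
(`exists_block_list`). The factors are separated by preserved cuts, hence independent.

Uniqueness is formal: the influence of an independent product is the union of the mutually
non-adjacent influences of its factors, so an element with connected influence has only itself as a
factor (`mem_of_prod_eq`). Any two solutions therefore contain each other. -/

namespace TypeA

open Equiv

/-! ### The Weyl group as a symmetric group -/

/-- The linear isometry permuting the coordinates. -/
noncomputable def permIsometry (r : ℕ) : Perm (Fin (r + 1)) →* (V r ≃ₗᵢ[ℝ] V r) where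
  toFun w := LinearIsometryEquiv.piLpCongrLeft 2 ℝ ℝ w
  map_one' := by ext v j; simp [LinearIsometryEquiv.piLpCongrLeft_apply, ← Perm.inv_def]
  map_mul' a b := by ext v j; simp [LinearIsometryEquiv.piLpCongrLeft_apply, Perm.mul_def]

theorem permIsometry_apply (r : ℕ) (w : Perm (Fin (r + 1))) (v : V r) (j : Fin (r + 1)) :
    permIsometry r w v j = v (w⁻¹ j) := by
  simp [permIsometry, LinearIsometryEquiv.piLpCongrLeft_apply, Perm.inv_def]

theorem permIsometry_injective (r : ℕ) : Function.Injective (permIsometry r) := by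
  intro a b h
  rw [← inv_inj]
  ext1 j
  -- Coordinate `j` of the image of this basis vector is 1 under `b`, and 0 under `a` unless `a⁻¹ j
  -- = b⁻¹ j`.
  have := congrArg (fun f : V r ≃ₗᵢ[ℝ] V r => f (EuclideanSpace.single (b⁻¹ j) 1) j) h
  simp only [permIsometry_apply] at this
  by_contra hne
  rw [PiLp.single_apply, PiLp.single_apply, if_neg hne] at this
  simp at this

/-- The transposition of two consecutive positions. -/
def adjSwap (r : ℕ) (i : Fin r) : Perm (Fin (r + 1)) := swap i.castSucc i.succ

theorem adjSwap_mul_self (r : ℕ) (i : Fin r) : adjSwap r i * adjSwap r i = 1 := swap_mul_self _ _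

theorem adjSwap_inv (r : ℕ) (i : Fin r) : (adjSwap r i)⁻¹ = adjSwap r i := swap_inv _ _

theorem val_adjSwap (r : ℕ) (i : Fin r) (j : Fin (r + 1)) :
    (adjSwap r i j).val =
      if j.val = i.val then i.val + 1 else if j.val = i.val + 1 then i.val else j.val := by
  rw [adjSwap, swap_apply_def]
  simp only [Fin.ext_iff, Fin.val_castSucc, Fin.val_succ]
  split_ifs <;> simp

open scoped InnerProductSpace in
theorem inner_simpleRoot (r : ℕ) (i : Fin r) (v : V r) :
    ⟪simpleRoot r i, v⟫_ℝ = v i.castSucc - v i.succ := by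
  simp [simpleRoot, inner_sub_left, EuclideanSpace.inner_single_left]

theorem simpleReflection_eq (r : ℕ) (i : Fin r) :
    simpleReflection r i = permIsometry r (adjSwap r i) := by
  ext v j
  rw [simpleReflection_apply, permIsometry_apply, adjSwap_inv, inner_simpleRoot, inner_simpleRoot]
  simp only [PiLp.sub_apply, PiLp.smul_apply, smul_eq_mul, simpleRoot_apply, adjSwap,
    swap_apply_def, Fin.ext_iff, Fin.val_castSucc, Fin.val_succ]
  by_cases h1 : j.val = i.val
  · have : j = i.castSucc := Fin.ext h1
    subst this
    simp
    ring
  · by_cases h2 : j.val = i.val + 1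
    · have : j = i.succ := Fin.ext h2
      subst this
      simp
      ring
    · simp [h1, h2]

theorem permIsometry_mem (r : ℕ) (w : Perm (Fin (r + 1))) : permIsometry r w ∈ weylGroup r := by
  have h : (⊤ : Submonoid (Perm (Fin (r + 1)))) ≤
      (weylGroup r).toSubmonoid.comap (permIsometry r) := by
    rw [← Equiv.Perm.mclosure_swap_castSucc_succ, Submonoid.closure_le]
    rintro _ ⟨i, rfl⟩
    change permIsometry r (adjSwap r i) ∈ weylGroup r
    rw [← simpleReflection_eq]
    exact Subgroup.subset_closure (Set.mem_range_self i)
  exact h (Submonoid.mem_top w)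

/-- The Weyl group is the symmetric group on the coordinates. -/
noncomputable def weylEquiv (r : ℕ) : Perm (Fin (r + 1)) ≃* weylGroup r :=
  MulEquiv.ofBijective ((permIsometry r).codRestrict (weylGroup r) (permIsometry_mem r)) <| by
    refine ⟨fun a b h => permIsometry_injective r (congrArg Subtype.val h), ?_⟩
    rintro ⟨x, hx⟩
    have h : weylGroup r ≤ (permIsometry r).range := by
      rw [weylGroup, Subgroup.closure_le]
      rintro _ ⟨i, rfl⟩
      exact ⟨adjSwap r i, (simpleReflection_eq r i).symm⟩
    obtain ⟨w, hw⟩ := h hx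
    exact ⟨w, Subtype.ext hw⟩

theorem refl_eq_weylEquiv (r : ℕ) (i : Fin r) : refl r i = weylEquiv r (adjSwap r i) :=
  Subtype.ext (simpleReflection_eq r i)

theorem prod_map_refl (r : ℕ) (ω : List (Fin r)) :
    (ω.map (refl r)).prod = weylEquiv r (ω.map (adjSwap r)).prod := by
  rw [map_list_prod, List.map_map]
  congr 2
  ext1 i
  exact refl_eq_weylEquiv r i

theorem exists_word (r : ℕ) (w : Perm (Fin (r + 1))) :
    ∃ ω : List (Fin r), (ω.map (adjSwap r)).prod = w := by
  have hw : w ∈ Submonoid.closure (Set.range fun i : Fin r => swap i.castSucc i.succ) := by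
    rw [Equiv.Perm.mclosure_swap_castSucc_succ]; trivial
  obtain ⟨l, hl, rfl⟩ := Submonoid.exists_list_of_mem_closure hw
  clear hw
  induction l with
  | nil => exact ⟨[], rfl⟩
  | cons a l ih =>
    obtain ⟨ω, hω⟩ := ih fun y hy => hl y (List.mem_cons_of_mem _ hy)
    obtain ⟨i, rfl⟩ := hl a List.mem_cons_self
    exact ⟨i :: ω, by rw [List.map_cons, List.prod_cons, List.prod_cons, hω]; rfl⟩

theorem exists_isReducedWord (r : ℕ) (σ : weylGroup r) : ∃ ω, IsReducedWord r ω σ := by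
  classical
  have hex : ∃ n, ∃ ω : List (Fin r), ω.length = n ∧ (ω.map (refl r)).prod = σ := by
    obtain ⟨ω, hω⟩ := exists_word r ((weylEquiv r).symm σ)
    exact ⟨_, ω, rfl, by rw [prod_map_refl, hω, MulEquiv.apply_symm_apply]⟩
  obtain ⟨ω, hlen, hω⟩ := Nat.find_spec hex
  exact ⟨ω, hω, fun ω' h' => hlen ▸ Nat.find_min' hex ⟨ω', rfl, h'⟩⟩

/-! ### Influence in terms of preserved cuts -/

/-- The permutations mapping the set of the positions `0, …, i` to itself. -/
def cutStabilizer (r : ℕ) (i : Fin r) : Subgroup (Perm (Fin (r + 1))) where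
  carrier := {w | ∀ j, (w j).val ≤ i.val ↔ j.val ≤ i.val}
  one_mem' := fun _ => Iff.rfl
  mul_mem' := fun {a b} ha hb j => (ha (b j)).trans (hb j)
  inv_mem' := fun {a} ha j => by simpa using (ha (a⁻¹ j)).symm

theorem mem_cutStabilizer {r : ℕ} {i : Fin r} {w : Perm (Fin (r + 1))} :
    w ∈ cutStabilizer r i ↔ ∀ j, (w j).val ≤ i.val ↔ j.val ≤ i.val := Iff.rfl

theorem adjSwap_mem_cutStabilizer {r : ℕ} {i j : Fin r} (h : i ≠ j) :
    adjSwap r i ∈ cutStabilizer r j := by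
  intro k
  rw [val_adjSwap]
  have : i.val ≠ j.val := fun h' => h (Fin.ext h')
  split_ifs <;> omega

theorem prod_mem_cutStabilizer {r : ℕ} {j : Fin r} {ω : List (Fin r)} (h : j ∉ ω) :
    (ω.map (adjSwap r)).prod ∈ cutStabilizer r j := by
  refine Subgroup.list_prod_mem _ fun x hx => ?_
  obtain ⟨i, hi, rfl⟩ := List.mem_map.1 hx
  exact adjSwap_mem_cutStabilizer fun h' => h (h' ▸ hi)

/-- If a word reverses the order of two positions, then one of its letters swaps them. -/
theorem exists_split_of_reverses (r : ℕ) (ω : List (Fin r)) : ∀ x y : Fin (r + 1), y < x →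
    (ω.map (adjSwap r)).prod⁻¹ x < (ω.map (adjSwap r)).prod⁻¹ y →
    ∃ a j b, ω = a ++ j :: b ∧ (a.map (adjSwap r)).prod⁻¹ x = j.succ ∧
      (a.map (adjSwap r)).prod⁻¹ y = j.castSucc := by
  induction ω with
  | nil => intro x y h h'; exact absurd h' (by simpa using h.le)
  | cons i ω ih =>
    intro x y h h'
    by_cases hxy : y = i.castSucc ∧ x = i.succ
    · exact ⟨[], i, ω, rfl, by simpa using hxy.2, by simpa using hxy.1⟩
    · simp only [List.map_cons, List.prod_cons, mul_inv_rev, adjSwap_inv, Perm.mul_apply] at h'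
      -- An adjacent transposition reverses only the pair that it exchanges, so the reversal is left
      -- to the later letters.
      have hlt : adjSwap r i y < adjSwap r i x := by
        rw [Fin.lt_def, val_adjSwap, val_adjSwap]
        simp only [Fin.ext_iff, Fin.val_castSucc, Fin.val_succ] at hxy
        rw [Fin.lt_def] at h
        split_ifs <;> omega
      obtain ⟨a, j, b, rfl, h1, h2⟩ := ih _ _ hlt h'
      refine ⟨i :: a, j, b, rfl, ?_, ?_⟩ <;>
        simpa only [List.map_cons, List.prod_cons, mul_inv_rev, adjSwap_inv, Perm.mul_apply]

/-- A word of a permutation stabilizing the cut after `i` can be shortened if it contains `i`. -/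
theorem exists_shorter_word {r : ℕ} {i : Fin r} {ω : List (Fin r)} (hi : i ∈ ω)
    (hω : (ω.map (adjSwap r)).prod ∈ cutStabilizer r i) :
    ∃ ω' : List (Fin r), ω'.length < ω.length ∧
      (ω'.map (adjSwap r)).prod = (ω.map (adjSwap r)).prod := by
  obtain ⟨u, c, rfl, hu⟩ := List.eq_append_cons_of_mem hi
  -- `u` stops before the first `i`, so it preserves the cut and can be cancelled.
  have hU := prod_mem_cutStabilizer hu
  have hC : adjSwap r i * (c.map (adjSwap r)).prod ∈ cutStabilizer r i := by
    rw [List.map_append, List.prod_append, List.map_cons, List.prod_cons] at hω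
    exact (Subgroup.mul_mem_cancel_left _ hU).1 hω
  have hC' := mem_cutStabilizer.1 (inv_mem hC)
  have h1 := hC' i.castSucc
  have h2 := hC' i.succ
  simp only [mul_inv_rev, adjSwap_inv, Perm.mul_apply, Fin.val_castSucc, Fin.val_succ] at h1 h2
  rw [adjSwap, swap_apply_left] at h1
  rw [adjSwap, swap_apply_right] at h2
  -- As `i` followed by `c` preserves the cut, `c` must undo the exchange across it: it reverses
  -- these two positions.
  obtain ⟨a, j, b, rfl, hx, hy⟩ := exists_split_of_reverses r c i.succ i.castSucc
    Fin.castSucc_lt_succ (by rw [Fin.lt_def]; omega)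
  refine ⟨u ++ (a ++ b), by simp, ?_⟩
  -- The letter `j` is the conjugate of `i` by `a`, so the letters `i` and `j` cancel.
  have hconj : (a.map (adjSwap r)).prod * adjSwap r j =
      adjSwap r i * (a.map (adjSwap r)).prod := by
    rw [adjSwap, adjSwap, mul_swap_eq_swap_mul, ← hx, ← hy]
    simp
  simp only [List.map_append, List.prod_append, List.map_cons, List.prod_cons]
  rw [← mul_assoc _ (adjSwap r j), hconj, mul_assoc (adjSwap r i), ← mul_assoc (adjSwap r i),
    adjSwap_mul_self, one_mul]

/-- A word avoiding `i` preserves the cut; a word containing `i` whose product preserves the cut is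
not reduced. So it does not matter which reduced word is used. -/
theorem mem_influence_iff {r : ℕ} {w : Perm (Fin (r + 1))} {i : Fin r} :
    i ∈ influence r (weylEquiv r w) ↔ w ∉ cutStabilizer r i := by
  constructor
  · rintro ⟨ω, ⟨hω, hmin⟩, hi⟩ hw
    rw [prod_map_refl, EmbeddingLike.apply_eq_iff_eq] at hω
    obtain ⟨ω', hlt, h'⟩ := exists_shorter_word hi (hω ▸ hw)
    exact absurd (hmin ω' (by rw [prod_map_refl, h', hω])) (by omega)
  · intro hw
    obtain ⟨ω, hω⟩ := exists_isReducedWord r (weylEquiv r w)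
    refine ⟨ω, hω, by_contra fun hi => hw ?_⟩
    have h1 := hω.1
    rw [prod_map_refl, EmbeddingLike.apply_eq_iff_eq] at h1
    exact h1 ▸ prod_mem_cutStabilizer hi

/-! ### Partial sums, partitions and the coordinates of `rho` -/

theorem sum_filter_val_lt_succ {N : ℕ} {M : Type*} [AddCommMonoid M] (f : Fin N → M) {m : ℕ}
    (h : m < N) : ∑ j ∈ Finset.univ.filter (fun j : Fin N => j.val < m + 1), f j =
      ∑ j ∈ Finset.univ.filter (fun j : Fin N => j.val < m), f j + f ⟨m, h⟩ := by
  have : Finset.univ.filter (fun j : Fin N => j.val < m + 1) =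
      insert ⟨m, h⟩ (Finset.univ.filter (fun j : Fin N => j.val < m)) := by
    ext j
    simp [Fin.ext_iff]
    omega
  rw [this, Finset.sum_insert (by simp), add_comm]

/-- A vector is determined by its partial sums. -/
theorem eq_of_partialSum_eq {r : ℕ} {x y : V r}
    (h : ∀ m : Fin r, ∑ j ∈ Finset.univ.filter (fun j : Fin (r + 1) => j.val ≤ m.val), x j =
      ∑ j ∈ Finset.univ.filter (fun j : Fin (r + 1) => j.val ≤ m.val), y j)
    (htot : ∑ j, x j = ∑ j, y j) : x = y := by
  have key : ∀ n ≤ r + 1, ∑ j ∈ Finset.univ.filter (fun j : Fin (r + 1) => j.val < n), x j =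
      ∑ j ∈ Finset.univ.filter (fun j : Fin (r + 1) => j.val < n), y j := by
    intro n hn
    rcases n with _ | n
    · simp
    · by_cases hr : n < r
      · simpa only [Nat.lt_succ_iff] using h ⟨n, hr⟩
      · have : ∀ j : Fin (r + 1), j.val < n + 1 := fun j => by omega
        simpa [this] using htot
  ext j
  have h1 := key (j.val + 1) (by omega)
  rw [sum_filter_val_lt_succ _ j.isLt, sum_filter_val_lt_succ _ j.isLt, key j.val (by omega)] at h1
  exact add_left_cancel h1

theorem sum_simpleRoot (r : ℕ) (k : Fin r) : ∑ j, simpleRoot r k j = 0 := by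
  simp [simpleRoot, Finset.sum_sub_distrib]

theorem sum_posRoot (r : ℕ) (p : PosIndex r) : ∑ j, posRoot r p j = 0 := by
  simp only [posRoot, WithLp.ofLp_sum, Finset.sum_apply]
  rw [Finset.sum_comm]
  simp [sum_simpleRoot]

/-- The partial sums are the coefficients in the simple roots. For a positive root they are 0 or 1,
and nonnegative integer coefficients are already a partition into simple roots. -/
theorem kostant_pos_iff (r : ℕ) (ξ : V r) (htot : ∑ j, ξ j = 0) (a : Fin r → ℤ)
    (ha : ∀ m : Fin r,
      ∑ j ∈ Finset.univ.filter (fun j : Fin (r + 1) => j.val ≤ m.val), ξ j = a m) :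
    0 < kostant r ξ ↔ ∀ m, 0 ≤ a m := by
  -- Finiteness matters: `Set.ncard` is 0 on infinite sets.
  rw [kostant, Set.ncard_pos (finite_partitions r ξ)]
  constructor
  · rintro ⟨c, hc⟩ m
    have hc : ∑ p, (c p : ℝ) • posRoot r p = ξ := hc
    have : (0 : ℝ) ≤ a m := by
      rw [← ha, ← hc]
      simp only [WithLp.ofLp_sum, Finset.sum_apply, PiLp.smul_apply, smul_eq_mul]
      rw [Finset.sum_comm]
      refine Finset.sum_nonneg fun p _ => ?_
      rw [← Finset.mul_sum, partialSum_posRoot]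
      positivity
    exact_mod_cast this
  · intro h
    refine ⟨fun p => if p.1.1 = p.1.2 then (a p.1.1).toNat else 0, ?_⟩
    change ∑ p : PosIndex r, ((if p.1.1 = p.1.2 then (a p.1.1).toNat else 0 : ℕ) : ℝ) •
      posRoot r p = ξ
    refine eq_of_partialSum_eq (fun m => ?_) ?_
    · rw [ha]
      simp only [WithLp.ofLp_sum, Finset.sum_apply, PiLp.smul_apply, smul_eq_mul]
      rw [Finset.sum_comm]
      simp only [← Finset.mul_sum, partialSum_posRoot]
      rw [Finset.sum_eq_single (⟨(m, m), le_rfl⟩ : PosIndex r)]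
      · have : ((a m).toNat : ℝ) = ((a m).toNat : ℤ) := by norm_cast
        simp [this, Int.toNat_of_nonneg (h m)]
      · rintro ⟨⟨i, j⟩, hij⟩ _ hne
        by_cases hij' : i = j
        · subst hij'
          have : ¬ (i ≤ m ∧ m ≤ i) := fun h' => hne (by
            have := le_antisymm h'.1 h'.2
            subst this; rfl)
          simp [this]
        · simp [hij']
      · simp
    · rw [htot]
      simp only [WithLp.ofLp_sum, Finset.sum_apply, PiLp.smul_apply, smul_eq_mul]
      rw [Finset.sum_comm]
      simp [← Finset.mul_sum, sum_posRoot]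

theorem sum_filter_val_le_affine {r : ℕ} (c : ℝ) (m : ℕ) (hm : m ≤ r) :
    ∑ j ∈ Finset.univ.filter (fun j : Fin (r + 1) => j.val ≤ m), (c - j.val) =
      (m + 1) * (c - m / 2) := by
  simp only [← Nat.lt_succ_iff]
  induction m with
  | zero => rw [sum_filter_val_lt_succ _ (by omega)]; simp
  | succ m ih => rw [sum_filter_val_lt_succ _ (by omega), ih (by omega)]; push_cast; ring

theorem partialSum_rho (r : ℕ) (m : Fin r) :
    ∑ j ∈ Finset.univ.filter (fun j : Fin (r + 1) => j.val ≤ m.val), rho r j =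
      (m.val + 1) * (r - m.val) / 2 := by
  simp only [rho, PiLp.smul_apply, WithLp.ofLp_sum, Finset.sum_apply, smul_eq_mul]
  rw [← Finset.mul_sum, Finset.sum_comm]
  simp only [partialSum_posRoot]
  rw [Finset.sum_boole]
  -- The simple root at `m` occurs in the positive roots that start at or before `m` and end at or
  -- after it.
  have hcard : (Finset.univ.filter fun p : PosIndex r => p.1.1 ≤ m ∧ m ≤ p.1.2).card =
      (Finset.Iic m ×ˢ Finset.Ici m).card := by
    refine Finset.card_bij (fun p _ => p.1) (fun p hp => by simpa using hp)
      (fun p _ q _ h => Subtype.ext h) fun q hq => ?_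
    rw [Finset.mem_product, Finset.mem_Iic, Finset.mem_Ici] at hq
    exact ⟨⟨q, hq.1.trans hq.2⟩, by simpa using hq, rfl⟩
  rw [hcard, Finset.card_product, Fin.card_Iic, Fin.card_Ici]
  push_cast [Nat.cast_sub m.isLt.le]
  ring

theorem rho_apply (r : ℕ) (j : Fin (r + 1)) : rho r j = (r : ℝ) / 2 - j.val := by
  have : rho r = WithLp.toLp 2 fun j : Fin (r + 1) => (r : ℝ) / 2 - j.val := by
    refine eq_of_partialSum_eq (fun m => ?_) ?_
    · rw [partialSum_rho]
      have := sum_filter_val_le_affine ((r : ℝ) / 2) m.val m.isLt.le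
      simp only [this]
      ring
    · have h1 := sum_filter_val_le_affine ((r : ℝ) / 2) r le_rfl
      have h2 : ∀ j : Fin (r + 1), j.val ≤ r := fun j => by omega
      simp only [h2, Finset.filter_true] at h1
      simp only [rho, PiLp.smul_apply, WithLp.ofLp_sum, Finset.sum_apply, smul_eq_mul]
      rw [h1, ← Finset.mul_sum, Finset.sum_comm]
      simp [sum_posRoot]
  rw [this]

theorem partialSum_highestRoot (r : ℕ) (m : Fin r) :
    ∑ j ∈ Finset.univ.filter (fun j : Fin (r + 1) => j.val ≤ m.val), highestRoot r j = 1 := by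
  simp only [highestRoot, WithLp.ofLp_sum, Finset.sum_apply]
  rw [Finset.sum_comm]
  simp [partialSum_simpleRoot]

theorem sum_highestRoot (r : ℕ) : ∑ j, highestRoot r j = 0 := by
  simp only [highestRoot, WithLp.ofLp_sum, Finset.sum_apply]
  rw [Finset.sum_comm]
  simp [sum_simpleRoot]

theorem highestRoot_eq (r : ℕ) :
    highestRoot r = EuclideanSpace.single 0 1 - EuclideanSpace.single (Fin.last r) 1 := by
  refine eq_of_partialSum_eq (fun m => ?_) ?_
  · rw [partialSum_highestRoot]
    simp [Finset.sum_sub_distrib, m.isLt.not_ge]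
  · rw [sum_highestRoot]
    simp [Finset.sum_sub_distrib]

/-! ### The alternation set as a bound on the excess -/

/-- The coordinates of `highestRoot r + rho r`, up to a sign and a common shift. -/
def level (r j : ℕ) : ℤ := j - (if j = 0 then 1 else 0) + (if j = r then 1 else 0)

theorem highestRoot_add_rho_apply (r : ℕ) (j : Fin (r + 1)) :
    (highestRoot r + rho r) j = (r : ℝ) / 2 - level r j.val := by
  rw [PiLp.add_apply, rho_apply, highestRoot_eq]
  simp only [PiLp.sub_apply, PiLp.single_apply, Fin.ext_iff, level, Fin.val_zero,
    Fin.val_last]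
  push_cast
  ring

/-- The amount by which the first `m` levels are increased by a rearrangement. -/
def excess (r : ℕ) (u : Perm (Fin (r + 1))) (m : ℕ) : ℤ :=
  ∑ j ∈ Finset.univ.filter (fun j : Fin (r + 1) => j.val < m), (level r (u j).val - j.val)

theorem excess_zero (r : ℕ) (u : Perm (Fin (r + 1))) : excess r u 0 = 0 := by simp [excess]

theorem excess_succ {r m : ℕ} (u : Perm (Fin (r + 1))) (h : m < r + 1) :
    excess r u (m + 1) = excess r u m + (level r (u ⟨m, h⟩).val - m) :=
  sum_filter_val_lt_succ _ h

theorem mem_alternationSet_iff {r : ℕ} {w : Perm (Fin (r + 1))} :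
    weylEquiv r w ∈ alternationSet r (highestRoot r) (-highestRoot r) ↔
      ∀ m < r, excess r w⁻¹ (m + 1) ≤ 1 := by
  change 0 < kostant r (permIsometry r w (highestRoot r + rho r) - -highestRoot r - rho r) ↔ _
  have hperm : ∑ j, permIsometry r w (highestRoot r + rho r) j = ∑ j, rho r j := by
    simp only [permIsometry_apply]
    rw [Equiv.sum_comp w⁻¹ (fun j => (highestRoot r + rho r) j)]
    simp [Finset.sum_add_distrib, sum_highestRoot]
  have hx : ∀ j, permIsometry r w (highestRoot r + rho r) j =
      (r : ℝ) / 2 - level r (w⁻¹ j).val := fun j => by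
    rw [permIsometry_apply, highestRoot_add_rho_apply]
  generalize permIsometry r w (highestRoot r + rho r) = x at hperm hx
  -- The 1 comes from subtracting `-highestRoot r`. The inverse appears because coordinate `j` of
  -- the image is coordinate `w⁻¹ j` of the original.
  rw [sub_neg_eq_add, kostant_pos_iff r _ ?_ fun m => 1 - excess r w⁻¹ (m.val + 1)]
  · constructor
    · intro h m hm
      have := h ⟨m, hm⟩
      simp only at this
      omega
    · intro h m
      have := h m.val m.isLt
      omega
  · intro m
    simp only [PiLp.sub_apply, PiLp.add_apply, Finset.sum_sub_distrib,
      Finset.sum_add_distrib, partialSum_highestRoot]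
    simp only [hx, rho_apply, excess, Nat.lt_succ_iff]
    push_cast
    simp only [Finset.sum_sub_distrib]
    ring
  · simp only [PiLp.sub_apply, PiLp.add_apply, Finset.sum_sub_distrib,
      Finset.sum_add_distrib, sum_highestRoot]
    rw [hperm]
    ring

/-- Rearranging positions on one side of a cut does not change the excess there. -/
theorem excess_mul {r : ℕ} {i : Fin r} (u : Perm (Fin (r + 1))) {b : Perm (Fin (r + 1))}
    (hb : b ∈ cutStabilizer r i) : excess r (u * b) (i.val + 1) = excess r u (i.val + 1) := by
  simp only [excess, Nat.lt_succ_iff, Finset.sum_sub_distrib]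
  congr 1
  exact Finset.sum_equiv b (fun j => by simpa using (hb j).symm) fun j _ => rfl

/-! ### Basic allowable blocks -/

/-- The transposition of the positions `k` and `k + 1` (the identity if `r ≤ k`). -/
def natSwap (r k : ℕ) : Perm (Fin (r + 1)) := if h : k < r then adjSwap r ⟨k, h⟩ else 1

theorem s_succ (r k : ℕ) : s r (k + 1) = weylEquiv r (natSwap r k) := by
  by_cases h : k < r
  · have h' : 1 ≤ k + 1 ∧ k + 1 ≤ r := by omega
    rw [s, dif_pos h', natSwap, dif_pos h, refl_eq_weylEquiv]
    rfl
  · have h' : ¬ (1 ≤ k + 1 ∧ k + 1 ≤ r) := by omega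
    rw [s, dif_neg h', natSwap, dif_neg h, map_one]

theorem natSwap_inv (r k : ℕ) : (natSwap r k)⁻¹ = natSwap r k := by
  unfold natSwap
  split_ifs <;> simp [adjSwap_inv]

theorem val_natSwap {r k : ℕ} (h : k < r) (j : Fin (r + 1)) :
    (natSwap r k j).val = if j.val = k then k + 1 else if j.val = k + 1 then k else j.val := by
  rw [natSwap, dif_pos h, val_adjSwap]

theorem natSwap_mem_cutStabilizer {r k : ℕ} {i : Fin r} (h : k ≠ i.val) :
    natSwap r k ∈ cutStabilizer r i := by
  unfold natSwap
  split_ifs with hk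
  · exact adjSwap_mem_cutStabilizer fun h' => h (congrArg Fin.val h')
  · exact one_mem _

/-- The basic allowable permutations moving exactly the positions from `n` to `e`
(except for the middle one if `b` reverses three positions). -/
def IsBlock (r n e : ℕ) (b : Perm (Fin (r + 1))) : Prop :=
  (e = n + 1 ∧ n + 1 ≤ r ∧ b = natSwap r n) ∨
  (e = n + 2 ∧ 1 ≤ n ∧ n + 3 ≤ r ∧ (b = natSwap r (n + 1) * natSwap r n ∨
    b = natSwap r n * natSwap r (n + 1) ∨
    b = natSwap r n * natSwap r (n + 1) * natSwap r n)) ∨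
  (e = n + 3 ∧ 1 ≤ n ∧ n + 4 ≤ r ∧ b = natSwap r (n + 2) * natSwap r n * natSwap r (n + 1))

namespace IsBlock

variable {r n e : ℕ} {b : Perm (Fin (r + 1))}

theorem bounds (h : IsBlock r n e b) : n < e ∧ e ≤ r := by
  unfold IsBlock at h
  omega

theorem mem_cutStabilizer_iff (h : IsBlock r n e b) (i : Fin r) :
    b ∈ cutStabilizer r i ↔ ¬ (n ≤ i.val ∧ i.val < e) := by
  have hb := h.bounds
  constructor
  · intro hs hi
    -- In every shape, each cut inside the block is crossed from left to right by `n` or by `n + 1`.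
    have h0 := hs ⟨n, by omega⟩
    have h1 := hs ⟨n + 1, by omega⟩
    rcases h with ⟨rfl, hr, rfl⟩ | ⟨rfl, hn, hr, rfl | rfl | rfl⟩ | ⟨rfl, hn, hr, rfl⟩ <;>
    · simp (disch := omega) [val_natSwap, if_neg] at h0 h1
      omega
  · intro hi
    have hmem : ∀ k, n ≤ k → k < e → natSwap r k ∈ cutStabilizer r i := fun k h1 h2 =>
      natSwap_mem_cutStabilizer (by omega)
    rcases h with ⟨rfl, hr, rfl⟩ | ⟨rfl, hn, hr, rfl | rfl | rfl⟩ | ⟨rfl, hn, hr, rfl⟩ <;>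
    · have h0 := hmem n le_rfl (by omega)
      first
      | exact h0
      | have h1 := hmem (n + 1) (by omega) (by omega)
        first
        | exact mul_mem h1 h0
        | exact mul_mem h0 h1
        | exact mul_mem (mul_mem h0 h1) h0
        | exact mul_mem (mul_mem (hmem (n + 2) (by omega) (by omega)) h0) h1

theorem apply_of_lt (h : IsBlock r n e b) {j : Fin (r + 1)} (hj : j.val < n) : b j = j := by
  have hb := h.bounds
  ext
  rcases h with ⟨rfl, hr, rfl⟩ | ⟨rfl, hn, hr, rfl | rfl | rfl⟩ | ⟨rfl, hn, hr, rfl⟩ <;>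
  · have h0 : j.val ≠ n := by omega
    have h1 : j.val ≠ n + 1 := by omega
    have h2 : j.val ≠ n + 2 := by omega
    have h3 : j.val ≠ n + 3 := by omega
    simp (disch := omega) [val_natSwap, h0, h1, h2, h3]

end IsBlock

theorem level_of_pos {r j : ℕ} (hj : 1 ≤ j) (hr : j < r) : level r j = j := by
  simp [level, show j ≠ 0 by omega, show j ≠ r by omega]

/-- Only the lowered level of position 0 counts, since position `r` lies beyond all these cuts. -/
theorem excess_one {r m : ℕ} (hm : 1 ≤ m) (hr : m ≤ r) : excess r 1 m = -1 := by
  induction m, hm using Nat.le_induction with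
  | base =>
    rw [excess_succ _ (by omega), excess_zero]
    simp [level, show (0 : ℕ) ≠ r by omega]
  | succ m hm ih =>
    rw [excess_succ _ (by omega), ih (by omega)]
    simp [level_of_pos hm (show m < r by omega)]

theorem excess_eq_excess_one {r m : ℕ} {u : Perm (Fin (r + 1))}
    (h : ∀ j : Fin (r + 1), j.val < m → u j = j) : excess r u m = excess r 1 m := by
  refine Finset.sum_congr rfl fun j hj => ?_
  rw [h j (by simpa using hj), Perm.one_apply]

/-- At a cut outside the block the excess is that of the identity; inside it is computed position by
position from its value at `n`. -/
theorem IsBlock.mem_alternationSet {r n e : ℕ} {b : Perm (Fin (r + 1))} (hr2 : 2 ≤ r)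
    (h : IsBlock r n e b) :
    weylEquiv r b ∈ alternationSet r (highestRoot r) (-highestRoot r) := by
  rw [mem_alternationSet_iff]
  intro m hm
  have hb := h.bounds
  by_cases hmem : n ≤ m ∧ m < e
  · have hn0 : n = 0 → excess r b⁻¹ n = 0 := fun h0 => by rw [h0, excess_zero]
    have hn1 : 1 ≤ n → excess r b⁻¹ n = -1 := fun h1 => by
      rw [excess_eq_excess_one, excess_one h1 (by omega)]
      exact fun j hj => Perm.inv_eq_iff_eq.2 (h.apply_of_lt hj).symm
    have e1 := excess_succ (r := r) (m := n) b⁻¹ (by omega)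
    rcases h with ⟨rfl, hr, rfl⟩ | ⟨rfl, hn, hr, h⟩ | ⟨rfl, hn, hr, rfl⟩
    · obtain rfl : m = n := by omega
      simp (disch := omega) [natSwap_inv, val_natSwap, level] at e1 hn0 hn1 ⊢
      split_ifs at e1 <;> omega
    · have e2 := excess_succ (r := r) (m := n + 1) b⁻¹ (by omega)
      have hm' : m = n ∨ m = n + 1 := by omega
      rcases h with rfl | rfl | rfl <;>
      · simp (disch := omega) [natSwap_inv, val_natSwap, if_neg, level_of_pos] at e1 e2 hn1 ⊢
        rcases hm' with rfl | rfl <;> omega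
    · have e2 := excess_succ (r := r) (m := n + 1) (natSwap r (n + 2) * natSwap r n *
        natSwap r (n + 1))⁻¹ (by omega)
      have e3 := excess_succ (r := r) (m := n + 2) (natSwap r (n + 2) * natSwap r n *
        natSwap r (n + 1))⁻¹ (by omega)
      have hm' : m = n ∨ m = n + 1 ∨ m = n + 2 := by omega
      simp (disch := omega) [natSwap_inv, val_natSwap, if_neg, level_of_pos] at e1 e2 e3 hn1 ⊢
      have e : excess r (natSwap r (n + 1) * (natSwap r n * natSwap r (n + 2))) (n + 2) =
        excess r (natSwap r (n + 1) * (natSwap r n * natSwap r (n + 2))) (n + 1 + 1) := rfl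
      rcases hm' with rfl | rfl | rfl <;> omega
  · have hs := (h.mem_cutStabilizer_iff ⟨m, hm⟩).2 hmem
    have := excess_mul (1 : Perm (Fin (r + 1))) (inv_mem hs)
    rw [one_mul] at this
    rw [this, excess_one (by omega) (by omega)]
    norm_num

/-! ### Splitting off blocks from the left -/

/-- The possible beginnings of a rearrangement of small excess. -/
theorem rearrangement_cases {r n : ℕ} {p : ℕ → ℕ} {E : ℕ → ℤ} (hr : 2 ≤ r) (hn : n < r)
    (hp : Function.Injective p) (hfix : ∀ j < n, p j = j) (hle : ∀ j ≤ r, p j ≤ r)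
    (hne : p n ≠ n) (hE0 : n = 0 → E n = 0) (hE1 : 1 ≤ n → E n = -1)
    (hsucc : ∀ m ≤ r, E (m + 1) = E m + (level r (p m) - m)) (hE : ∀ m < r, E (m + 1) ≤ 1) :
    (p n = n + 1 ∧ p (n + 1) = n) ∨
    (1 ≤ n ∧ n + 3 ≤ r ∧ ((p n = n + 1 ∧ p (n + 1) = n + 2 ∧ p (n + 2) = n) ∨
      (p n = n + 2 ∧ p (n + 1) = n ∧ p (n + 2) = n + 1) ∨
      (p n = n + 2 ∧ p (n + 1) = n + 1 ∧ p (n + 2) = n))) ∨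
    (1 ≤ n ∧ n + 4 ≤ r ∧ p n = n + 2 ∧ p (n + 1) = n ∧ p (n + 2) = n + 3 ∧
      p (n + 3) = n + 1) := by
  have hge : ∀ j, n ≤ j → n ≤ p j := fun j hj => by
    by_contra hlt
    have := hp (hfix (p j) (by omega))
    omega
  have hlevel : ∀ j, (j = 0 → level r j = -1) ∧ (1 ≤ j → j < r → level r j = j) ∧
      (j = r → level r j = r + 1) := fun j => by
    simp only [level]
    split_ifs <;> omega
  have hneq : ∀ i j, i ≠ j → p i ≠ p j := fun i j h h' => h (hp h')
  have hstep : ∀ m, n ≤ m → m ≤ r → ∀ q, p m = q →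
      n ≤ q ∧ q ≤ r ∧ (q = 0 → E (m + 1) = E m - 1 - m) ∧
        (1 ≤ q → q < r → E (m + 1) = E m + q - m) ∧ (q = r → E (m + 1) = E m + r + 1 - m) := by
    rintro m hnm hm q rfl
    have l := hlevel (p m)
    have s := hsucc m hm
    refine ⟨hge m hnm, hle m hm, fun h => ?_, fun h h' => ?_, fun h => ?_⟩
    · rw [s, l.1 h]; ring
    · rw [s, l.2.1 h h']; ring
    · rw [s, l.2.2 h]; ring
  have d01 := hneq n (n + 1) (by omega)
  have e2 : E (n + 2) = E (n + 1 + 1) := rfl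
  have e3 : E (n + 3) = E (n + 2 + 1) := rfl
  generalize h0 : p n = a at *
  have s0 := hstep n le_rfl hn.le a h0
  have c0 := hE n hn
  -- A rise by 2 needs the initial excess -1, so `n ≠ 0`, and must avoid position `r`, whose level
  -- is one higher.
  have ha : (a = n + 1) ∨ (a = n + 2 ∧ 1 ≤ n ∧ n + 2 < r) := by omega
  generalize h1 : p (n + 1) = b at *
  have s1 := hstep (n + 1) (by omega) (by omega) b h1
  have c1 := hE (n + 1)
  rcases Nat.lt_or_ge (n + 1) r with hn1 | hn1
  swap
  · left
    omega
  have c1 := c1 hn1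
  have hab : (a = n + 1 ∧ b = n) ∨ (1 ≤ n ∧ n + 2 < r ∧ ((a = n + 1 ∧ b = n + 2) ∨
      (a = n + 2 ∧ b = n) ∨ (a = n + 2 ∧ b = n + 1))) := by
    rcases ha with ha | ha <;> omega
  clear ha
  rcases hab with hab | ⟨hn0, hn2, hab⟩
  · exact Or.inl hab
  have s0 := s0.2.2.2.1
  have s1 := s1.2.2.2.1
  have hE1 := hE1 hn0
  clear hE0 c0
  have d02 := hneq n (n + 2) (by omega)
  have d12 := hneq (n + 1) (n + 2) (by omega)
  generalize h2 : p (n + 2) = c at *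
  have s2 := hstep (n + 2) (by omega) (by omega) c h2
  have c2 := hE (n + 2) hn2
  rcases hab with ⟨rfl, rfl⟩ | ⟨rfl, rfl⟩ | ⟨rfl, rfl⟩
  · have : c = n := by omega
    exact Or.inr (Or.inl ⟨hn0, hn2, Or.inl ⟨rfl, rfl, this⟩⟩)
  -- Here `b` stands for `n`. The excess has dropped back to 0, which allows one more rise by 1 and
  -- so the pattern of length four.
  · have hc : c = b + 1 ∨ (c = b + 3 ∧ b + 3 < r) := by omega
    rcases hc with rfl | ⟨rfl, hn3⟩
    · exact Or.inr (Or.inl ⟨hn0, hn2, Or.inr (Or.inl ⟨rfl, rfl, rfl⟩)⟩)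
    · have d03 := hneq b (b + 3) (by omega)
      have d13 := hneq (b + 1) (b + 3) (by omega)
      have d23 := hneq (b + 2) (b + 3) (by omega)
      have s3 := hstep (b + 3) (by omega) (by omega) _ rfl
      have c3 := hE (b + 3) hn3
      have s2 := s2.2.2.2.1
      have : p (b + 3) = b + 1 := by omega
      exact Or.inr (Or.inr ⟨hn0, hn3, rfl, rfl, rfl, this⟩)
  · have : c = n := by omega
    exact Or.inr (Or.inl ⟨hn0, hn2, Or.inr (Or.inr ⟨rfl, rfl, this⟩)⟩)

/-- A permutation in the alternation set starts with a basic allowable one. -/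
theorem exists_isBlock {r n : ℕ} {w : Perm (Fin (r + 1))} (hr : 2 ≤ r) (hn : n < r)
    (hfix : ∀ j : Fin (r + 1), j.val < n → w j = j) (hne : w ⟨n, by omega⟩ ≠ ⟨n, by omega⟩)
    (hw : ∀ m < r, excess r w⁻¹ (m + 1) ≤ 1) :
    ∃ e b, IsBlock r n e b ∧ ∀ j : Fin (r + 1), n ≤ j.val → j.val ≤ e → w j = b j := by
  -- The extension by the identity keeps `p` injective on all of `ℕ`.
  set p : ℕ → ℕ := fun j => if h : j < r + 1 then (w⁻¹ ⟨j, h⟩).val else j with hp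
  have hpj : ∀ j (h : j < r + 1), p j = (w⁻¹ ⟨j, h⟩).val := fun j h => dif_pos h
  have hfix' : ∀ j : Fin (r + 1), j.val < n → w⁻¹ j = j := fun j hj =>
    Perm.inv_eq_iff_eq.2 (hfix j hj).symm
  have hval : ∀ a j, a < r + 1 → p a = j → ∀ k : Fin (r + 1), k.val = j → (w k).val = a := by
    intro a j ha hj k hk
    have : w⁻¹ ⟨a, ha⟩ = k := Fin.ext (by rw [← hpj a ha, hj, hk])
    rw [← this]
    simp
  have := rearrangement_cases (r := r) (n := n) (p := p) (E := excess r w⁻¹) hr hn ?_ ?_ ?_ ?_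
    ?_ ?_ ?_ hw
  · rcases this with ⟨h0, h1⟩ | ⟨hn1, hr3, ⟨h0, h1, h2⟩ | ⟨h0, h1, h2⟩ | ⟨h0, h1, h2⟩⟩ |
      ⟨hn1, hr4, h0, h1, h2, h3⟩
    · refine ⟨n + 1, _, Or.inl ⟨rfl, hn, rfl⟩, fun j hj hj' => ?_⟩
      have v0 := hval _ _ (by omega) h0 j
      have v1 := hval _ _ (by omega) h1 j
      ext
      obtain hj | hj : j.val = n ∨ j.val = n + 1 := by omega
      all_goals
        simp (disch := omega) [val_natSwap, hj]
        omega
    · refine ⟨n + 2, _, Or.inr (Or.inl ⟨rfl, hn1, hr3, Or.inl rfl⟩), fun j hj hj' => ?_⟩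
      have v0 := hval _ _ (by omega) h0 j
      have v1 := hval _ _ (by omega) h1 j
      have v2 := hval _ _ (by omega) h2 j
      ext
      obtain hj | hj | hj : j.val = n ∨ j.val = n + 1 ∨ j.val = n + 2 := by omega
      all_goals
        simp (disch := omega) [val_natSwap, if_neg, hj]
        omega
    · refine ⟨n + 2, _, Or.inr (Or.inl ⟨rfl, hn1, hr3, Or.inr (Or.inl rfl)⟩),
        fun j hj hj' => ?_⟩
      have v0 := hval _ _ (by omega) h0 j
      have v1 := hval _ _ (by omega) h1 j
      have v2 := hval _ _ (by omega) h2 j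
      ext
      obtain hj | hj | hj : j.val = n ∨ j.val = n + 1 ∨ j.val = n + 2 := by omega
      all_goals
        simp (disch := omega) [val_natSwap, if_neg, hj]
        omega
    · refine ⟨n + 2, _, Or.inr (Or.inl ⟨rfl, hn1, hr3, Or.inr (Or.inr rfl)⟩),
        fun j hj hj' => ?_⟩
      have v0 := hval _ _ (by omega) h0 j
      have v1 := hval _ _ (by omega) h1 j
      have v2 := hval _ _ (by omega) h2 j
      ext
      obtain hj | hj | hj : j.val = n ∨ j.val = n + 1 ∨ j.val = n + 2 := by omega
      all_goals
        simp (disch := omega) [val_natSwap, if_neg, hj]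
        omega
    · refine ⟨n + 3, _, Or.inr (Or.inr ⟨rfl, hn1, hr4, rfl⟩), fun j hj hj' => ?_⟩
      have v0 := hval _ _ (by omega) h0 j
      have v1 := hval _ _ (by omega) h1 j
      have v2 := hval _ _ (by omega) h2 j
      have v3 := hval _ _ (by omega) h3 j
      ext
      obtain hj | hj | hj | hj :
        j.val = n ∨ j.val = n + 1 ∨ j.val = n + 2 ∨ j.val = n + 3 := by omega
      all_goals
        simp (disch := omega) [val_natSwap, if_neg, hj]
        omega
  · intro a b hab
    simp only [hp] at hab
    split_ifs at hab with ha hb hb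
    · simpa using Fin.ext hab
    · omega
    · omega
    · exact hab
  · intro j hj
    rw [hpj j (by omega), hfix' _ hj]
  · intro j hj
    rw [hpj j (by omega)]
    omega
  · rw [hpj n (by omega)]
    intro h
    exact hne (Perm.inv_eq_iff_eq.1 (Fin.ext h)).symm
  · rintro rfl
    exact excess_zero r _
  · intro h1
    rw [excess_eq_excess_one hfix', excess_one h1 hn.le]
  · intro m hm
    rw [excess_succ _ (by omega), hpj m (by omega)]

/-- A permutation in the alternation set is a product of basic allowable permutations that are
separated from each other. -/
theorem exists_block_list {r : ℕ} (hr : 2 ≤ r) (d : ℕ) : ∀ (n : ℕ) (w : Perm (Fin (r + 1))),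
    r ≤ n + d → (∀ j : Fin (r + 1), j.val < n → w j = j) →
    (∀ m < r, excess r w⁻¹ (m + 1) ≤ 1) →
    ∃ l : List (Perm (Fin (r + 1))), l.prod = w ∧
      (∀ b ∈ l, ∃ k e, n ≤ k ∧ IsBlock r k e b) ∧
      l.Pairwise fun a b => ∃ k e k' e', IsBlock r k e a ∧ IsBlock r k' e' b ∧ e < k' := by
  induction d with
  | zero =>
    intro n w hn hfix _
    refine ⟨[], ?_, by simp, by simp⟩
    have hlast : w (Fin.last r) = Fin.last r := by
      by_contra hne
      have hlt : (w (Fin.last r)).val < r := by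
        have : (w (Fin.last r)).val ≠ r := fun h => hne (Fin.ext h)
        omega
      exact hne (w.injective (hfix _ (by omega)))
    ext1 j
    by_cases hj : j.val < r
    · simpa using (hfix j (by omega)).symm
    · obtain rfl : j = Fin.last r := Fin.ext (by rw [Fin.val_last]; omega)
      simpa using hlast.symm
  | succ d ih =>
    intro n w hn hfix hw
    by_cases hnr : r ≤ n
    · exact ih n w (by omega) hfix hw
    by_cases hwn : w ⟨n, by omega⟩ = ⟨n, by omega⟩
    · obtain ⟨l, hl, hl', hl''⟩ := ih (n + 1) w (by omega) (fun j hj => by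
        rcases Nat.lt_succ_iff_lt_or_eq.1 hj with hj | hj
        · exact hfix j hj
        · have : j = ⟨n, by omega⟩ := Fin.ext hj
          rw [this, hwn]) hw
      refine ⟨l, hl, fun b hb => ?_, hl''⟩
      obtain ⟨k, e, hk, h⟩ := hl' b hb
      exact ⟨k, e, by omega, h⟩
    · obtain ⟨e, b, hb, hbw⟩ := exists_isBlock hr (by omega) hfix hwn hw
      have hbounds := hb.bounds
      have hfix' : ∀ j : Fin (r + 1), j.val < e + 1 → (b⁻¹ * w) j = j := by
        intro j hj
        rw [Perm.mul_apply, Perm.inv_eq_iff_eq]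
        by_cases hjn : j.val < n
        · rw [hfix j hjn, hb.apply_of_lt hjn]
        · exact hbw j (by omega) (by omega)
      -- The bound is inherited: before `e` the quotient has the excess of the identity, and from
      -- `e` on `b` preserves the cut. Restarting at `e + 1` leaves the label `e` unused between
      -- blocks.
      obtain ⟨l, hl, hl', hl''⟩ := ih (e + 1) (b⁻¹ * w) (by omega) hfix' (fun m hm => by
        by_cases hme : m < e
        · rw [excess_eq_excess_one fun j hj => Perm.inv_eq_iff_eq.2 (hfix' j (by omega)).symm,
            excess_one (by omega) (by omega)]
          norm_num
        · rw [mul_inv_rev, inv_inv]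
          have := excess_mul w⁻¹ ((hb.mem_cutStabilizer_iff ⟨m, hm⟩).2 (by simp; omega))
          rw [this]
          exact hw m hm)
      refine ⟨b :: l, by rw [List.prod_cons, hl, mul_inv_cancel_left], ?_, ?_⟩
      · intro c hc
        rcases List.mem_cons.1 hc with rfl | hc
        · exact ⟨n, e, le_rfl, hb⟩
        · obtain ⟨k, e', hk, h⟩ := hl' c hc
          exact ⟨k, e', by omega, h⟩
      · refine List.pairwise_cons.2 ⟨fun c hc => ?_, hl''⟩
        obtain ⟨k, e', hk, h⟩ := hl' c hc
        exact ⟨n, e, k, e', hb, h, by omega⟩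

/-! ### Connectedness and independence of blocks -/

open scoped InnerProductSpace in
theorem dynkin_adj_iff {r : ℕ} {i j : Fin r} :
    (dynkin r).Adj i j ↔ i.val + 1 = j.val ∨ j.val + 1 = i.val := by
  change i ≠ j ∧ ⟪simpleRoot r i, simpleRoot r j⟫_ℝ ≠ 0 ↔ _
  rw [inner_simpleRoot, simpleRoot_apply, simpleRoot_apply, ne_eq, Fin.ext_iff, Fin.val_castSucc,
    Fin.val_succ]
  split_ifs <;> first | omega | (norm_num; omega)

theorem hasConnectedInfluence_of_interval {r n e : ℕ} {σ : weylGroup r} (hne : n < e) (her : e ≤ r)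
    (h : ∀ i, i ∈ influence r σ ↔ n ≤ i.val ∧ i.val < e) : HasConnectedInfluence r σ := by
  rw [HasConnectedInfluence, SimpleGraph.connected_iff_exists_forall_reachable]
  have hmem : ∀ k (hk : n + k < e), (⟨n + k, by omega⟩ : Fin r) ∈ influence r σ := fun k hk =>
    (h _).2 ⟨Nat.le_add_right n k, hk⟩
  have key : ∀ k (hk : n + k < e), ((dynkin r).induce (influence r σ)).Reachable
      ⟨⟨n, by omega⟩, hmem 0 (by omega)⟩ ⟨⟨n + k, by omega⟩, hmem k hk⟩ := by
    intro k
    induction k with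
    | zero => exact fun _ => SimpleGraph.Reachable.refl _
    | succ k ih =>
      intro hk
      refine (ih (by omega)).trans (SimpleGraph.Adj.reachable ?_)
      rw [SimpleGraph.induce_adj, dynkin_adj_iff]
      exact Or.inl rfl
  refine ⟨⟨⟨n, by omega⟩, hmem 0 (by omega)⟩, fun ⟨i, hi⟩ => ?_⟩
  obtain ⟨h1, h2⟩ := (h i).1 hi
  convert key (i.val - n) (by omega) using 3
  omega

theorem IsBlock.mem_influence_iff {r n e : ℕ} {b : Perm (Fin (r + 1))} (h : IsBlock r n e b)
    (i : Fin r) : i ∈ influence r (weylEquiv r b) ↔ n ≤ i.val ∧ i.val < e := by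
  rw [TypeA.mem_influence_iff, h.mem_cutStabilizer_iff, not_not]

theorem IsBlock.hasConnectedInfluence {r n e : ℕ} {b : Perm (Fin (r + 1))} (h : IsBlock r n e b) :
    HasConnectedInfluence r (weylEquiv r b) :=
  hasConnectedInfluence_of_interval h.bounds.1 h.bounds.2 h.mem_influence_iff

theorem independent_comm {r : ℕ} {σ τ : weylGroup r} (h : Independent r σ τ) :
    Independent r τ σ := by
  rw [Independent, Set.eq_empty_iff_forall_notMem] at h ⊢
  rintro i ⟨hi, hi' | ⟨j, hj, hij⟩⟩
  · exact h i ⟨hi', Or.inl hi⟩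
  · exact h j ⟨hj, Or.inr ⟨i, hi, hij.symm⟩⟩

theorem IsBlock.independent {r n e n' e' : ℕ} {a b : Perm (Fin (r + 1))} (ha : IsBlock r n e a)
    (hb : IsBlock r n' e' b) (h : e < n') : Independent r (weylEquiv r a) (weylEquiv r b) := by
  rw [Independent, Set.eq_empty_iff_forall_notMem]
  rintro i ⟨hi, hi' | ⟨j, hj, hij⟩⟩
  · rw [ha.mem_influence_iff] at hi
    rw [hb.mem_influence_iff] at hi'
    omega
  · rw [ha.mem_influence_iff] at hi
    rw [hb.mem_influence_iff] at hj
    rw [dynkin_adj_iff] at hij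
    omega

theorem influence_one (r : ℕ) : influence r 1 = ∅ := by
  rw [Set.eq_empty_iff_forall_notMem]
  intro i
  rw [← map_one (weylEquiv r), mem_influence_iff, not_not]
  exact one_mem _

theorem influence_nonempty {r : ℕ} {σ : weylGroup r} (h : HasConnectedInfluence r σ) :
    (influence r σ).Nonempty := Set.nonempty_coe_sort.1 h.nonempty

theorem ne_one_of_hasConnectedInfluence {r : ℕ} {σ : weylGroup r} (h : HasConnectedInfluence r σ) :
    σ ≠ 1 := by
  rintro rfl
  have := influence_nonempty h
  rw [influence_one] at this
  exact Set.not_nonempty_empty this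

/-! ### Uniqueness of the set of basic allowable subwords -/

/-- The elements whose influence does not contain `i` form a subgroup. -/
noncomputable def parabolic (r : ℕ) (i : Fin r) : Subgroup (weylGroup r) :=
  (cutStabilizer r i).map (weylEquiv r).toMonoidHom

theorem mem_parabolic_iff {r : ℕ} {i : Fin r} {σ : weylGroup r} :
    σ ∈ parabolic r i ↔ i ∉ influence r σ := by
  obtain ⟨w, rfl⟩ := (weylEquiv r).surjective σ
  rw [mem_influence_iff, not_not]
  exact Subgroup.mem_map_iff_mem (weylEquiv r).injective

/-- The influence of a product of pairwise independent elements is the union of the influences. -/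
theorem mem_influence_prod_iff {r : ℕ} {l : List (weylGroup r)} (hl : l.Nodup)
    (hind : PairwiseIndependent r {b | b ∈ l}) (i : Fin r) :
    i ∈ influence r l.prod ↔ ∃ b ∈ l, i ∈ influence r b := by
  rw [← not_iff_not, ← mem_parabolic_iff]
  push Not
  simp only [← mem_parabolic_iff]
  refine ⟨fun h b hb => ?_, Subgroup.list_prod_mem _⟩
  obtain ⟨l₁, l₂, rfl⟩ := List.append_of_mem hb
  by_contra hbi
  -- By independence at most one factor has `i` in its influence; the others lie in a subgroup and
  -- cancel.
  have hother : ∀ c ∈ l₁ ++ b :: l₂, c ≠ b → c ∈ parabolic r i := by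
    intro c hc hcb
    by_contra hci
    rw [mem_parabolic_iff, not_not] at hbi hci
    exact Set.eq_empty_iff_forall_notMem.1 (hind c hc b hb hcb) i ⟨hci, Or.inl hbi⟩
  rw [List.nodup_middle, List.nodup_cons] at hl
  have h₁ : l₁.prod ∈ parabolic r i := Subgroup.list_prod_mem _ fun c hc =>
    hother c (by simp [hc]) fun h' => hl.1 (by simp [← h', hc])
  have h₂ : l₂.prod ∈ parabolic r i := Subgroup.list_prod_mem _ fun c hc =>
    hother c (by simp [hc]) fun h' => hl.1 (by simp [← h', hc])
  rw [List.prod_append, List.prod_cons, Subgroup.mul_mem_cancel_left _ h₁,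
    Subgroup.mul_mem_cancel_right _ h₂] at h
  exact hbi h

/-- An element with connected influence is not a product of several independent elements. -/
theorem mem_of_prod_eq {r : ℕ} {l : List (weylGroup r)} {σ : weylGroup r} (hl : l.Nodup)
    (hind : PairwiseIndependent r {b | b ∈ l}) (hconn : ∀ b ∈ l, HasConnectedInfluence r b)
    (hprod : l.prod = σ) (hσ : HasConnectedInfluence r σ) : σ ∈ l := by
  rcases l with _ | ⟨b, _ | ⟨c, l⟩⟩
  · exact absurd hprod.symm (ne_one_of_hasConnectedInfluence hσ)
  · simpa using hprod.symm
  · exfalso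
    subst hprod
    have hbc : c ≠ b := fun h => by simp [h] at hl
    have hinf := mem_influence_prod_iff hl hind
    obtain ⟨i, hi⟩ := influence_nonempty (hconn b (by simp))
    obtain ⟨j, hj⟩ := influence_nonempty (hconn c (by simp))
    have hreach := hσ.preconnected ⟨i, (hinf i).2 ⟨b, by simp, hi⟩⟩ ⟨j, (hinf j).2 ⟨c, by simp, hj⟩⟩
    obtain ⟨p⟩ := hreach
    -- A walk cannot leave the influence of `b`: the next vertex would lie in the influence of
    -- another factor while adjacent to that of `b`.
    have hwalk : ∀ x y : influence r (b :: c :: l).prod,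
        ((dynkin r).induce (influence r (b :: c :: l).prod)).Walk x y →
        x.1 ∈ influence r b → y.1 ∈ influence r b := by
      intro x y p
      induction p with
      | nil => exact id
      | @cons x y z hxy _ ih =>
        intro hx
        apply ih
        obtain ⟨d, hd, hyd⟩ := (hinf y.1).1 y.2
        by_cases hdb : d = b
        · exact hdb ▸ hyd
        · rw [SimpleGraph.induce_adj] at hxy
          exact (Set.eq_empty_iff_forall_notMem.1 (hind d hd b (by simp) hdb) y.1
            ⟨hyd, Or.inr ⟨x.1, hx, hxy.symm⟩⟩).elim
    exact Set.eq_empty_iff_forall_notMem.1 (hind c (by simp) b (by simp) hbc) j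
      ⟨hj, Or.inl (hwalk _ _ p hi)⟩

/-- There is at most one set of basic allowable subwords. -/
theorem IsBAS.subset {r : ℕ} {lam mu : V r} {S T : Set (weylGroup r)} (hS : IsBAS r lam mu S)
    (hT : IsBAS r lam mu T) : S ⊆ T := by
  intro σ hσ
  obtain ⟨l, hl, hlT, hind, hprod⟩ := hT.2.2.2 σ (hS.1 hσ)
  exact hlT σ (mem_of_prod_eq hl hind (fun b hb => hT.2.2.1 b (hlT b hb)) hprod (hS.2.2.1 σ hσ))

/-! ### The explicit set -/

/-- The basic allowable elements for the highest root and its negative. -/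
def basicSet (r : ℕ) : Set (weylGroup r) :=
  {σ | ∃ n e b, IsBlock r n e b ∧ weylEquiv r b = σ}

theorem isBAS_basicSet {r : ℕ} (hr : 2 ≤ r) :
    IsBAS r (highestRoot r) (-highestRoot r) (basicSet r) := by
  refine ⟨?_, ?_, ?_, ?_⟩
  · rintro _ ⟨n, e, b, hb, rfl⟩
    exact hb.mem_alternationSet hr
  · rintro ⟨n, e, b, hb, h⟩
    exact ne_one_of_hasConnectedInfluence hb.hasConnectedInfluence h
  · rintro _ ⟨n, e, b, hb, rfl⟩
    exact hb.hasConnectedInfluence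
  · intro σ hσ
    obtain ⟨w, rfl⟩ := (weylEquiv r).surjective σ
    obtain ⟨l, hprod, hl, hpair⟩ := exists_block_list hr r 0 w (by omega) (by simp)
      (mem_alternationSet_iff.1 hσ)
    have hpair' : (l.map (weylEquiv r)).Pairwise fun a b =>
        a ≠ b ∧ Independent r a b := by
      rw [List.pairwise_map]
      refine hpair.imp fun {a b} h => ?_
      obtain ⟨k, e, k', e', ha, hb, hlt⟩ := h
      refine ⟨fun hab => ?_, ha.independent hb hlt⟩
      -- The left end of the first block lies in its influence but not in that of the later block,
      -- so the two differ.
      have := ha.mem_influence_iff ⟨k, by have := ha.bounds; omega⟩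
      rw [hab, hb.mem_influence_iff] at this
      have := ha.bounds
      simp only at *
      omega
    refine ⟨l.map (weylEquiv r), hpair'.imp fun h => h.1, ?_, ?_, ?_⟩
    · intro b hb
      obtain ⟨a, ha, rfl⟩ := List.mem_map.1 hb
      obtain ⟨k, e, -, h⟩ := hl a ha
      exact ⟨k, e, a, h, rfl⟩
    · intro a ha b hb hab
      have : Std.Symm (Independent r) := ⟨fun _ _ => independent_comm⟩
      exact (hpair'.imp fun h => h.2 : List.Pairwise (Independent r) _).forall ha hb hab
    · rw [← map_list_prod, hprod]

theorem mem_basicSet_iff {r : ℕ} {σ : weylGroup r} : σ ∈ basicSet r ↔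
    (∃ k, 1 ≤ k ∧ k ≤ r ∧ σ = s r k) ∨
    (∃ k, 2 ≤ k ∧ k + 2 ≤ r ∧ σ = s r (k + 1) * s r k) ∨
    (∃ k, 2 ≤ k ∧ k + 2 ≤ r ∧ σ = s r k * s r (k + 1)) ∨
    (∃ k, 2 ≤ k ∧ k + 2 ≤ r ∧ σ = s r k * s r (k + 1) * s r k) ∨
    (∃ k, 2 ≤ k ∧ k + 3 ≤ r ∧ σ = s r (k + 2) * s r k * s r (k + 1)) := by
  constructor
  · rintro ⟨n, e, b, ⟨-, hr, rfl⟩ | ⟨-, hn, hr, rfl | rfl | rfl⟩ | ⟨-, hn, hr, rfl⟩, rfl⟩ <;>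
      simp only [map_mul, ← s_succ]
    · exact Or.inl ⟨n + 1, by omega, hr, rfl⟩
    · exact Or.inr (Or.inl ⟨n + 1, by omega, by omega, rfl⟩)
    · exact Or.inr (Or.inr (Or.inl ⟨n + 1, by omega, by omega, rfl⟩))
    · exact Or.inr (Or.inr (Or.inr (Or.inl ⟨n + 1, by omega, by omega, rfl⟩)))
    · exact Or.inr (Or.inr (Or.inr (Or.inr ⟨n + 1, by omega, by omega, rfl⟩)))
  · rintro (⟨k, hk, hr, rfl⟩ | ⟨k, hk, hr, rfl⟩ | ⟨k, hk, hr, rfl⟩ | ⟨k, hk, hr, rfl⟩ |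
      ⟨k, hk, hr, rfl⟩) <;> obtain ⟨n, rfl⟩ : ∃ n, k = n + 1 := ⟨k - 1, by omega⟩
    · exact ⟨n, _, _, Or.inl ⟨rfl, hr, rfl⟩, (s_succ r n).symm⟩
    · exact ⟨n, _, _, Or.inr (Or.inl ⟨rfl, by omega, by omega, Or.inl rfl⟩),
        by simp only [map_mul, ← s_succ]⟩
    · exact ⟨n, _, _, Or.inr (Or.inl ⟨rfl, by omega, by omega, Or.inr (Or.inl rfl)⟩),
        by simp only [map_mul, ← s_succ]⟩
    · exact ⟨n, _, _, Or.inr (Or.inl ⟨rfl, by omega, by omega, Or.inr (Or.inr rfl)⟩),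
        by simp only [map_mul, ← s_succ]⟩
    · exact ⟨n, _, _, Or.inr (Or.inr ⟨rfl, by omega, by omega, rfl⟩),
        by simp only [map_mul, ← s_succ]⟩

end TypeA

theorem mainTheorem5 (r : ℕ) (hr : 2 ≤ r) (S : Set (TypeA.weylGroup r)) :
    TypeA.IsBAS r (TypeA.highestRoot r) (-TypeA.highestRoot r) S ↔
      S = {σ | (∃ k, 1 ≤ k ∧ k ≤ r ∧ σ = TypeA.s r k) ∨
               (∃ k, 2 ≤ k ∧ k + 2 ≤ r ∧ σ = TypeA.s r (k + 1) * TypeA.s r k) ∨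
               (∃ k, 2 ≤ k ∧ k + 2 ≤ r ∧ σ = TypeA.s r k * TypeA.s r (k + 1)) ∨
               (∃ k, 2 ≤ k ∧ k + 2 ≤ r ∧
                  σ = TypeA.s r k * TypeA.s r (k + 1) * TypeA.s r k) ∨
               (∃ k, 2 ≤ k ∧ k + 3 ≤ r ∧
                  σ = TypeA.s r (k + 2) * TypeA.s r k * TypeA.s r (k + 1))} := by
  have hset : TypeA.basicSet r = _ := Set.ext fun σ => TypeA.mem_basicSet_iff
  have hbasic := TypeA.isBAS_basicSet hr
  rw [hset] at hbasic
  exact ⟨fun hS => (hS.subset hbasic).antisymm (hbasic.subset hS), fun hS => hS ▸ hbasic⟩
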